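/- Let $k$ be a field, let $n\ge 3$ and $t\ge 1$ be integers, and let $S=k[x_1,\ldots,x_n]$ with the standard grading. Let $$I_n=(x_1x_2\cdots x_{n-1},\; x_2x_3\cdots x_n,\; x_3\cdots x_nx_1,\;\ldots,\; x_nx_1\cdots x_{n-2})\subset S$$ be the $(n-1)$-path ideal of the cycle of length $n$, generated by the $n$ products of $n-1$ cyclically consecutive variables. For a finitely generated graded $S$-module $M$, let $\beta_i(M)=\dim_k \operatorname{Tor}_i^S(k,M)$ and $\beta_{i,j}(M)=\dim_k\operatorname{Tor}_i^S(k,M)_j$, where $k=S/(x_1,\ldots,x_n)$, and define the projective dimension and the Castelnuovo–Mumford regularity by $$\operatorname{pd}_S(M)=\sup\{i : \beta_i(M)\ne 0\},\qquad \operatorname{reg}_S(M)=\sup\{j-i : \beta_{i,j}(M)\neq 0\}.$$ Then 1. $\operatorname{pd}_S(I_n^t)=\min\{n-1,t\}$; 2. $\operatorname{reg}_S(I_n^t)=(n-1)t$. -/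

import Mathlib

open MvPolynomial TensorProduct

universe u v

noncomputable section

namespace GradedPoly

variable (k : Type u) [Field k] (n : ℕ)

/-- The polynomial ring `S = k[x₁, …, xₙ]`; the variables are indexed by `Fin n`. -/
abbrev S : Type u := MvPolynomial (Fin n) k

/-- The standard `ℤ`-grading of `S`: every variable has degree `1` (so the pieces of negative
degree are zero). -/
def polyPiece (d : ℤ) : Submodule k (S k n) :=
  weightedHomogeneousSubmodule k (fun _ : Fin n => (1 : ℤ)) d

variable {k n}

/-- The degree `d` piece of the graded free module `⨁_b S(-deg b)`. -/
def freePiece {ι : Type u} (deg : ι → ℤ) (d : ℤ) : Submodule k (ι →₀ S k n) where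
  carrier := {f | ∀ b, f b ∈ polyPiece k n (d - deg b)}
  add_mem' hf hg b := by simpa using add_mem (hf b) (hg b)
  zero_mem' b := by simp
  smul_mem' c f hf b := by simpa using Submodule.smul_mem _ c (hf b)

variable (k n)

/-- The residue field `k = S/(x₁, …, xₙ)` as an `S`-module. -/
abbrev Residue : Type u := S k n ⧸ idealOfVars (Fin n) k

/-- A graded free resolution of `k = S/(x₁, …, xₙ)` (with `k` in degree `0`) over `S`:
an exact complex `⋯ → F 1 → F 0 → k → 0`, where `F i = ⨁_b S(-deg i b)` and all maps are
homogeneous of degree `0`. -/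
structure GradedFreeResolution where
  ι : ℕ → Type u
  deg : ∀ i, ι i → ℤ
  d : ∀ i, (ι (i + 1) →₀ S k n) →ₗ[S k n] (ι i →₀ S k n)
  aug : (ι 0 →₀ S k n) →ₗ[S k n] Residue k n
  d_homogeneous : ∀ i e x, x ∈ freePiece (deg (i + 1)) e → d i x ∈ freePiece (deg i) e
  aug_homogeneous : ∀ e x, x ∈ freePiece (deg 0) e → e ≠ 0 → aug x = 0
  aug_surjective : Function.Surjective aug
  exact_zero : Function.Exact (d 0) aug
  exact_succ : ∀ i, Function.Exact (d (i + 1)) (d i)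

variable {k n}

/-! ### Existence: the canonical resolution -/

/-- The homogeneous component of degree `e` in a graded free module. -/
def freeComp {ι : Type u} (deg : ι → ℤ) (e : ℤ) (x : ι →₀ S k n) : ι →₀ S k n :=
  Finsupp.onFinset x.support
    (fun b => weightedHomogeneousComponent (fun _ : Fin n => (1 : ℤ)) (e - deg b) (x b))
    (fun b hb => by
      rw [Finsupp.mem_support_iff]
      intro h
      exact hb (by rw [h, map_zero]))

lemma freeComp_apply {ι : Type u} (deg : ι → ℤ) (e : ℤ) (x : ι →₀ S k n) (b : ι) :
    freeComp deg e x b =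
      weightedHomogeneousComponent (fun _ : Fin n => (1 : ℤ)) (e - deg b) (x b) := rfl

lemma freeComp_add {ι : Type u} (deg : ι → ℤ) (e : ℤ) (x y : ι →₀ S k n) :
    freeComp deg e (x + y) = freeComp deg e x + freeComp deg e y := by
  ext1 b
  simp [freeComp_apply]

lemma freeComp_zero {ι : Type u} (deg : ι → ℤ) (e : ℤ) :
    freeComp deg e (0 : ι →₀ S k n) = 0 := by
  ext1 b
  simp [freeComp_apply]

lemma freeComp_mem {ι : Type u} (deg : ι → ℤ) (e : ℤ) (x : ι →₀ S k n) :
    freeComp deg e x ∈ freePiece deg e := fun b => by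
  rw [freeComp_apply]
  exact weightedHomogeneousComponent_mem _ _ _

lemma freeComp_of_mem {ι : Type u} (deg : ι → ℤ) (e d : ℤ) (x : ι →₀ S k n)
    (hx : x ∈ freePiece deg d) : freeComp deg e x = if e = d then x else 0 := by
  ext1 b
  rw [freeComp_apply, weightedHomogeneousComponent_of_mem (hx b)]
  by_cases h : e = d
  · simp [h]
  · simp [h]

lemma free_induction {ι : Type u} (deg : ι → ℤ) (P : (ι →₀ S k n) → Prop) (h0 : P 0)
    (hadd : ∀ x y, P x → P y → P (x + y)) (hhom : ∀ e x, x ∈ freePiece deg e → P x)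
    (x : ι →₀ S k n) : P x := by
  classical
  induction x using Finsupp.induction_linear with
  | zero => exact h0
  | add f g hf hg => exact hadd f g hf hg
  | single b p =>
    induction p using MvPolynomial.induction_on' with
    | monomial m a =>
      refine hhom (Finsupp.weight (fun _ : Fin n => (1 : ℤ)) m + deg b) _ fun c => ?_
      by_cases hc : b = c
      · subst hc
        simpa [polyPiece] using
          isWeightedHomogeneous_monomial (fun _ : Fin n => (1 : ℤ)) m a rfl
      · rw [Finsupp.single_eq_of_ne' hc]
        exact zero_mem _
    | add p q hp hq =>
      rw [Finsupp.single_add]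
      exact hadd _ _ hp hq

lemma map_freeComp {ι κ : Type u} (deg : ι → ℤ) (deg' : κ → ℤ)
    (f : (ι →₀ S k n) →ₗ[S k n] (κ →₀ S k n))
    (hf : ∀ e x, x ∈ freePiece deg e → f x ∈ freePiece deg' e) (e : ℤ) (x : ι →₀ S k n) :
    f (freeComp deg e x) = freeComp deg' e (f x) := by
  induction x using free_induction deg with
  | h0 => simp [freeComp_zero]
  | hadd x y hx hy => simp [freeComp_add, hx, hy]
  | hhom d x hx =>
    rw [freeComp_of_mem deg e d x hx, freeComp_of_mem deg' e d (f x) (hf d x hx)]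
    split_ifs <;> simp

lemma exists_sum_freeComp {ι : Type u} (deg : ι → ℤ) (x : ι →₀ S k n) :
    ∃ E : Finset ℤ, ∀ E', E ⊆ E' → ∑ e ∈ E', freeComp deg e x = x := by
  classical
  induction x using free_induction deg with
  | h0 => exact ⟨∅, fun E' _ => by simp [freeComp_zero]⟩
  | hadd x y hx hy =>
    obtain ⟨A, hA⟩ := hx
    obtain ⟨B, hB⟩ := hy
    refine ⟨A ∪ B, fun E' h => ?_⟩
    simp only [freeComp_add, Finset.sum_add_distrib]
    rw [hA E' (Finset.union_subset_left h), hB E' (Finset.union_subset_right h)]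
  | hhom d x hx =>
    refine ⟨{d}, fun E' h => ?_⟩
    simp only [freeComp_of_mem deg _ d x hx]
    simpa using fun hd => absurd (h (Finset.mem_singleton_self d)) hd

variable (k n)

/-- A graded free module `⨁_b S(-deg b)` with a submodule `syz` that is generated by homogeneous
elements. -/
structure Stage where
  ι : Type u
  deg : ι → ℤ
  syz : Submodule (S k n) (ι →₀ S k n)
  syz_le : syz ≤ Submodule.span (S k n) {x | x ∈ syz ∧ ∃ e, x ∈ freePiece deg e}

variable {k n}

/-- One basis element for every homogeneous element `p.2`, of degree `p.1`, of `syz`. -/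
abbrev Stage.nextIndex (A : Stage k n) : Type u :=
  {p : ℤ × (A.ι →₀ S k n) // p.2 ∈ A.syz ∧ p.2 ∈ freePiece A.deg p.1}

/-- The map that sends each basis element to the homogeneous element that it stands for. -/
def Stage.nextMap (A : Stage k n) : (A.nextIndex →₀ S k n) →ₗ[S k n] (A.ι →₀ S k n) :=
  Finsupp.linearCombination (S k n) (fun p : A.nextIndex => p.1.2)

lemma Stage.nextMap_homogeneous (A : Stage k n) (e : ℤ) (x : A.nextIndex →₀ S k n)
    (hx : x ∈ freePiece (fun p : A.nextIndex => p.1.1) e) :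
    A.nextMap x ∈ freePiece A.deg e := by
  rw [Stage.nextMap, Finsupp.linearCombination_apply]
  refine Submodule.sum_mem _ fun p _ b => ?_
  have h1 : (x p).IsWeightedHomogeneous (fun _ : Fin n => (1 : ℤ)) (e - p.1.1) := hx p
  have h2 : (p.1.2 b).IsWeightedHomogeneous (fun _ : Fin n => (1 : ℤ)) (p.1.1 - A.deg b) :=
    p.2.2 b
  have h3 := h1.mul h2
  rw [sub_add_sub_cancel] at h3
  exact h3

lemma Stage.range_nextMap (A : Stage k n) : LinearMap.range A.nextMap = A.syz := by
  rw [Stage.nextMap, Finsupp.range_linearCombination]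
  apply le_antisymm
  · rw [Submodule.span_le]
    rintro _ ⟨p, rfl⟩
    exact p.2.1
  · refine A.syz_le.trans (Submodule.span_mono ?_)
    rintro x ⟨hx, e, he⟩
    exact ⟨⟨(e, x), hx, he⟩, rfl⟩

/-- The next stage: its submodule is the kernel of `nextMap`. -/
def Stage.next (A : Stage k n) : Stage k n where
  ι := A.nextIndex
  deg p := p.1.1
  syz := LinearMap.ker A.nextMap
  syz_le x hx := by
    obtain ⟨E, hE⟩ := exists_sum_freeComp (fun p : A.nextIndex => p.1.1) x
    rw [← hE E subset_rfl]
    refine Submodule.sum_mem _ fun e _ => Submodule.subset_span ⟨?_, e, freeComp_mem _ _ _⟩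
    rw [LinearMap.mem_ker, map_freeComp _ A.deg _ A.nextMap_homogeneous, LinearMap.mem_ker.1 hx,
      freeComp_zero]

variable (k n)

/-- The augmentation `S → S/(x₁, …, xₙ)`. -/
def augmentation : (PUnit.{u + 1} →₀ S k n) →ₗ[S k n] Residue k n :=
  (idealOfVars (Fin n) k).mkQ ∘ₗ Finsupp.lapply PUnit.unit

/-- The first stage: the free module `S` with the submodule `(x₁, …, xₙ)`. -/
def stageZero : Stage k n where
  ι := PUnit
  deg _ := 0
  syz := LinearMap.ker (augmentation k n)
  syz_le x hx := by
    have hx' : x PUnit.unit ∈ idealOfVars (Fin n) k := by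
      rw [LinearMap.mem_ker] at hx
      exact (Submodule.Quotient.mk_eq_zero _).1 hx
    have key : ∀ p ∈ idealOfVars (Fin n) k, Finsupp.single PUnit.unit p ∈
        Submodule.span (S k n) {x : PUnit.{u + 1} →₀ S k n |
          x ∈ LinearMap.ker (augmentation k n) ∧ ∃ e, x ∈ freePiece (fun _ => 0) e} := by
      intro p hp
      rw [idealOfVars] at hp
      induction hp using Submodule.span_induction with
      | mem p hp =>
        obtain ⟨i, rfl⟩ := hp
        refine Submodule.subset_span ⟨?_, 1, fun b => ?_⟩
        · exact (Submodule.Quotient.mk_eq_zero _).2 <| by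
            rw [Finsupp.lapply_apply, Finsupp.single_eq_same]
            exact Ideal.subset_span (Set.mem_range_self i)
        · simpa [polyPiece] using isWeightedHomogeneous_X k (fun _ : Fin n => (1 : ℤ)) i
      | zero => simp
      | add p q _ _ hp hq =>
        rw [Finsupp.single_add]
        exact add_mem hp hq
      | smul a p _ hp =>
        rw [← Finsupp.smul_single]
        exact Submodule.smul_mem _ a hp
    have hs := key _ hx'
    rwa [← Finsupp.unique_single x] at hs

/-- The stages of the canonical resolution. -/
def stage : ℕ → Stage k n
  | 0 => stageZero k n
  | i + 1 => (stage i).next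

/-- The canonical graded free resolution of `k`: in each step one takes the graded free module on
all homogeneous elements of the kernel of the previous map. -/
def canonicalResolution : GradedFreeResolution k n where
  ι i := (stage k n i).ι
  deg i := (stage k n i).deg
  d i := (stage k n i).nextMap
  aug := augmentation k n
  d_homogeneous i := (stage k n i).nextMap_homogeneous
  aug_homogeneous e x hx he := by
    have h : x PUnit.unit ∈ idealOfVars (Fin n) k := by
      rw [← pow_one (idealOfVars (Fin n) k), mem_pow_idealOfVars_iff']
      intro m hm
      by_contra hc
      have h1 : Finsupp.weight (fun _ : Fin n => (1 : ℤ)) m = e - 0 := hx PUnit.unit hc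
      have h2 : m = 0 := by
        rw [← Finsupp.degree_eq_zero_iff]
        omega
      rw [h2, map_zero] at h1
      omega
    exact (Submodule.Quotient.mk_eq_zero _).2 h
  aug_surjective := by
    intro y
    obtain ⟨p, rfl⟩ := Submodule.mkQ_surjective _ y
    exact ⟨Finsupp.single PUnit.unit p,
      congrArg (idealOfVars (Fin n) k).mkQ (Finsupp.single_eq_same (a := PUnit.unit))⟩
  exact_zero y := (SetLike.ext_iff.1 (Stage.range_nextMap (stageZero k n)) y).symm
  exact_succ i y := (SetLike.ext_iff.1 (Stage.range_nextMap (stage k n (i + 1))) y).symm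

/-! ### Graded Tor and Betti numbers -/

variable {k n}
variable (P : GradedFreeResolution k n)
variable (M : Type v) [AddCommGroup M] [Module k M] [Module (S k n) M] [IsScalarTower k (S k n) M]

/-- The free module `F i` of a graded free resolution. -/
def GradedFreeResolution.F (i : ℕ) : Type u := P.ι i →₀ S k n

instance (i : ℕ) : AddCommGroup (P.F i) := inferInstanceAs (AddCommGroup (P.ι i →₀ S k n))

instance (i : ℕ) : Module (S k n) (P.F i) := inferInstanceAs (Module (S k n) (P.ι i →₀ S k n))

instance (i : ℕ) : Module k (P.F i) := inferInstanceAs (Module k (P.ι i →₀ S k n))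

instance (i : ℕ) : IsScalarTower k (S k n) (P.F i) :=
  inferInstanceAs (IsScalarTower k (S k n) (P.ι i →₀ S k n))

/-- The differential `F (i + 1) → F i`. -/
def GradedFreeResolution.dF (i : ℕ) : P.F (i + 1) →ₗ[S k n] P.F i := P.d i

/-- The degree `a` piece of `F i`. -/
def GradedFreeResolution.pieceF (i : ℕ) (a : ℤ) : Submodule k (P.F i) := freePiece (P.deg i) a

/-- The term `F i ⊗ M` of the complex `F ⊗ M`. -/
abbrev chain (i : ℕ) : Type (max u v) := P.F i ⊗[S k n] M

/-- The differential `F (i + 1) ⊗ M → F i ⊗ M`. -/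
def differential (i : ℕ) : chain P M (i + 1) →ₗ[S k n] chain P M i :=
  (P.dF i).rTensor M

/-- The cycles of `F ⊗ M` in homological degree `i`. -/
def cycles : (i : ℕ) → Submodule (S k n) (chain P M i)
  | 0 => ⊤
  | i + 1 => LinearMap.ker (differential P M i)

/-- The boundaries of `F ⊗ M` in homological degree `i`. -/
def boundaries (i : ℕ) : Submodule (S k n) (chain P M i) :=
  LinearMap.range (differential P M i)

/-- `Tor_i^S(k, M)`, the homology of `F ⊗ M`, for a graded free resolution `F` of `k`. -/
abbrev Tor (i : ℕ) : Type (max u v) :=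
  cycles P M i ⧸ (boundaries P M i).submoduleOf (cycles P M i)

variable {M} (𝓜 : ℤ → Submodule k M)

/-- The degree `j` piece of `F i ⊗ M`, for the grading `𝓜` of `M`. -/
def chainPiece (i : ℕ) (j : ℤ) : Submodule k (chain P M i) :=
  Submodule.span k {z | ∃ a b : ℤ, a + b = j ∧
    ∃ p ∈ P.pieceF i a, ∃ m ∈ 𝓜 b, p ⊗ₜ[S k n] m = z}

/-- `Tor_i^S(k, M)_j`: the classes of the cycles of degree `j`. -/
def torPiece (i : ℕ) (j : ℤ) : Submodule k (Tor P M i) :=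
  ((chainPiece P 𝓜 i j).comap ((cycles P M i).subtype.restrictScalars k)).map
    (((boundaries P M i).submoduleOf (cycles P M i)).mkQ.restrictScalars k)

variable (M) in
/-- The Betti number `β_i(M) = dim_k Tor_i^S(k, M)`. -/
def betti (i : ℕ) : Cardinal := Module.rank k (Tor (canonicalResolution k n) M i)

/-- The graded Betti number `β_{i,j}(M) = dim_k Tor_i^S(k, M)_j`, for the grading `𝓜` of `M`. -/
def gradedBetti (i : ℕ) (j : ℤ) : Cardinal :=
  Module.rank k (torPiece (canonicalResolution k n) 𝓜 i j)

variable (M) in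
/-- The projective dimension `sup {i | β_i(M) ≠ 0}` (`⊥` if there is no such `i`, and `⊤` if the
set is unbounded). -/
def projDim : WithBot ℕ∞ :=
  sSup {p | ∃ i : ℕ, betti (k := k) (n := n) M i ≠ 0 ∧ p = ((i : ℕ∞) : WithBot ℕ∞)}

/-- The Castelnuovo–Mumford regularity `sup {j - i | β_{i,j}(M) ≠ 0}` (`⊥` if there are no such
`i` and `j`, and `⊤` if the set is not bounded above). -/
def regularity : WithBot (WithTop ℤ) :=
  sSup {r | ∃ (i : ℕ) (j : ℤ), gradedBetti (n := n) 𝓜 i j ≠ 0 ∧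
    r = ((j - i : ℤ) : WithTop ℤ)}

/-! ### Ideals, and the path ideals of cycles -/

/-- The grading of an ideal `I` of `S` induced by the standard grading: `I_d = I ∩ S_d`. -/
def idealPiece (I : Ideal (S k n)) (d : ℤ) : Submodule k I :=
  (polyPiece k n d).comap (I.subtype.restrictScalars k)

/-- The projective dimension of an ideal of `S`, as an `S`-module. -/
def idealProjDim (I : Ideal (S k n)) : WithBot ℕ∞ := projDim (k := k) (n := n) I

/-- The regularity of a homogeneous ideal of `S`, as a graded `S`-module. -/
def idealRegularity (I : Ideal (S k n)) : WithBot (WithTop ℤ) :=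
  regularity (n := n) (idealPiece I)

variable (k n)

/-- The `m`-path ideal of the `n`-cycle, generated by the products
`x_i x_{i+1} ⋯ x_{i+m-1}`, `i = 1, …, n`, with indices taken modulo `n`. -/
def cyclePathIdeal (m : ℕ) : Ideal (S k n) :=
  Ideal.span (Set.range fun i : Fin n => ∏ j ∈ Finset.range m, X ((finRotate n ^ j) i))

end GradedPoly

end

/-! Write `n + 1` for the number of variables. A path on `n` of the `n + 1` vertices omits exactly
one, so the generators are `x / x_l` with `x = x₀ ⋯ xₙ`, and the `t`-th power is generated by the
monomials `x^t / x^a` with `|a| = t`, all of degree `n t`. In lexicographic order of `a` these have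
linear quotients: the colon of the `a`-th by the preceding ones is generated by the `x_i` with `i ≠
n` and `a_i ≠ 0` (`exists_mem_colonVariables_iff`). At most `min n t` variables occur, and this
bound is attained.

For linear quotients, add one generator `u` at a time, using `0 → (J : u)(-d) → J ⊕ S(-d) → J + (u)
→ 0` with `d = deg u`. Ideals of variables have the `Tor` of a truncated Koszul complex, so `Tor_i`
vanishes in degrees `j > i + n t` and for `i > min n t`, while a top class appears and then persists
(`vanishes_and_survives_of_linear_quotients`). These facts give both invariants.

The modules `F i` are flat, so `F ⊗ J` is the subcomplex `J F ⊆ F`. The long exact sequence thus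
becomes a chase with elements of `F`, valid for any graded free resolution of `k`. -/

namespace GradedPoly

/-! ### Tor of an ideal through the subcomplex `J F`, and the colon sequence -/

section CoefficientSubcomplexes

variable {k : Type u} [Field k] {n : ℕ}

/-- The elements of a free module all of whose coefficients lie in the ideal `J`. -/
def coeffIn (J : Ideal (S k n)) (ι : Type u) : Submodule (S k n) (ι →₀ S k n) where
  carrier := {f | ∀ b, f b ∈ J}
  add_mem' hf hg b := J.add_mem (hf b) (hg b)
  zero_mem' _ := J.zero_mem
  smul_mem' c _ hf b := J.mul_mem_left c (hf b)

lemma coeffIn_mono {J K : Ideal (S k n)} (h : J ≤ K) (ι : Type u) :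
    coeffIn J ι ≤ coeffIn K ι := fun _ hf b => h (hf b)

lemma map_mem_coeffIn {ι κ : Type u} (f : (ι →₀ S k n) →ₗ[S k n] (κ →₀ S k n))
    (J : Ideal (S k n)) {x : ι →₀ S k n} (hx : x ∈ coeffIn J ι) : f x ∈ coeffIn J κ := by
  classical
  rw [← Finsupp.sum_single x, Finsupp.sum, map_sum]
  refine Submodule.sum_mem _ fun b _ c => ?_
  rw [← mul_one (x b), ← smul_eq_mul, ← Finsupp.smul_single, map_smul]
  exact J.mul_mem_right _ (hx b)

lemma smul_mem_freePiece {ι : Type u} {deg : ι → ℤ} {d e : ℤ} {u : S k n}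
    (hu : u ∈ polyPiece k n d) {x : ι →₀ S k n} (hx : x ∈ freePiece deg e) :
    u • x ∈ freePiece deg (e + d) := fun b => by
  have h1 : u.IsWeightedHomogeneous (fun _ : Fin n => (1 : ℤ)) d := hu
  have h2 : (x b).IsWeightedHomogeneous (fun _ : Fin n => (1 : ℤ)) (e - deg b) := hx b
  have h3 := h1.mul h2
  rwa [show d + (e - deg b) = e + d - deg b by ring] at h3

lemma freeComp_smul {ι : Type u} (deg : ι → ℤ) {d : ℤ} {u : S k n} (hu : u ∈ polyPiece k n d)
    (e : ℤ) (x : ι →₀ S k n) : freeComp deg (e + d) (u • x) = u • freeComp deg e x := by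
  induction x using free_induction deg with
  | h0 => simp [freeComp_zero]
  | hadd x y hx hy => simp only [smul_add, freeComp_add, hx, hy]
  | hhom c x hx =>
    rw [freeComp_of_mem deg e c x hx, freeComp_of_mem deg _ _ _ (smul_mem_freePiece hu hx)]
    simp only [add_left_inj, smul_ite, smul_zero]

/-- An ideal that contains the homogeneous components of its elements. -/
def IsHomogeneousIdeal (J : Ideal (S k n)) : Prop :=
  ∀ p ∈ J, ∀ e : ℤ, weightedHomogeneousComponent (fun _ : Fin n => (1 : ℤ)) e p ∈ J

lemma IsHomogeneousIdeal.freeComp_mem {J : Ideal (S k n)} (hJ : IsHomogeneousIdeal J)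
    {ι : Type u} (deg : ι → ℤ) (e : ℤ) {x : ι →₀ S k n} (hx : x ∈ coeffIn J ι) :
    freeComp deg e x ∈ coeffIn J ι := fun b => by
  rw [freeComp_apply]
  exact hJ _ (hx b) _

lemma exists_add_smul_of_mem_coeffIn_sup {J : Ideal (S k n)} {u : S k n} {ι : Type u}
    {z : ι →₀ S k n} (hz : z ∈ coeffIn (J ⊔ Ideal.span {u}) ι) :
    ∃ p ∈ coeffIn J ι, ∃ q : ι →₀ S k n, z = p + u • q := by
  classical
  -- The second clause makes the chosen coefficients finitely supported.
  have h : ∀ b, ∃ q : S k n, z b - u * q ∈ J ∧ (z b = 0 → q = 0) := fun b => by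
    by_cases hb : z b = 0
    · exact ⟨0, by simp [hb], fun _ => rfl⟩
    obtain ⟨p, hp, r, hr, hpr⟩ := Submodule.mem_sup.1 (hz b)
    obtain ⟨q, rfl⟩ := Ideal.mem_span_singleton.1 hr
    exact ⟨q, by rwa [← hpr, add_sub_cancel_right], fun h => absurd h hb⟩
  choose q hq hq0 using h
  let Q : ι →₀ S k n := Finsupp.onFinset z.support q fun b hb => by
    rw [Finsupp.mem_support_iff]
    exact fun h => hb (hq0 b h)
  exact ⟨z - u • Q, fun b => hq b, Q, (sub_add_cancel _ _).symm⟩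

lemma exists_homogeneous_add_smul {J : Ideal (S k n)} (hJ : IsHomogeneousIdeal J) {d j : ℤ}
    {u : S k n} (hu : u ∈ polyPiece k n d) {ι : Type u} (deg : ι → ℤ) {z : ι →₀ S k n}
    (hz : z ∈ coeffIn (J ⊔ Ideal.span {u}) ι) (hzj : z ∈ freePiece deg j) :
    ∃ p ∈ coeffIn J ι, p ∈ freePiece deg j ∧ ∃ q ∈ freePiece deg (j - d), z = p + u • q := by
  obtain ⟨p, hp, q, hpq⟩ := exists_add_smul_of_mem_coeffIn_sup hz
  refine ⟨freeComp deg j p, hJ.freeComp_mem deg j hp, freeComp_mem _ _ _,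
    freeComp deg (j - d) q, freeComp_mem _ _ _, ?_⟩
  rw [← freeComp_smul deg hu, sub_add_cancel, ← freeComp_add, ← hpq, freeComp_of_mem _ _ _ _ hzj,
    if_pos rfl]

/-- Here and below, `hC` expresses that `C` is the colon ideal `J : u`. -/
lemma smul_mem_coeffIn {J C : Ideal (S k n)} {u : S k n} (hC : ∀ s, s ∈ C ↔ u * s ∈ J)
    {ι : Type u} {x : ι →₀ S k n} : u • x ∈ coeffIn J ι ↔ x ∈ coeffIn C ι :=
  forall_congr' fun b => (hC (x b)).symm

lemma smul_mem_coeffIn_sup {J : Ideal (S k n)} {u : S k n} {ι : Type u} (x : ι →₀ S k n) :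
    u • x ∈ coeffIn (J ⊔ Ideal.span {u}) ι := fun _ =>
  Ideal.mem_sup_right (Ideal.mul_mem_right _ _ (Ideal.mem_span_singleton_self u))

variable (P : GradedFreeResolution k n)

/-- The cycles of the complex `F`. -/
noncomputable def freeCycles : (i : ℕ) → Submodule (S k n) (P.ι i →₀ S k n)
  | 0 => ⊤
  | i + 1 => LinearMap.ker (P.d i)

lemma d_mem_freeCycles (i : ℕ) (x : P.ι (i + 1) →₀ S k n) : P.d i x ∈ freeCycles P i := by
  cases i with
  | zero => trivial
  | succ i => exact (P.exact_succ i _).2 ⟨x, rfl⟩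

lemma freeComp_mem_freeCycles {i : ℕ} (e : ℤ) {x : P.ι i →₀ S k n} (hx : x ∈ freeCycles P i) :
    freeComp (P.deg i) e x ∈ freeCycles P i := by
  cases i with
  | zero => trivial
  | succ i =>
    have hx' : P.d i x = 0 := hx
    change P.d i _ = 0
    rw [map_freeComp _ (P.deg i) _ (P.d_homogeneous i), hx', freeComp_zero]

lemma exists_homogeneous_preimage {i : ℕ} {e : ℤ} {x : P.ι (i + 1) →₀ S k n}
    (hx : P.d i x ∈ freePiece (P.deg i) e) :
    ∃ y ∈ freePiece (P.deg (i + 1)) e, P.d i y = P.d i x :=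
  ⟨freeComp (P.deg (i + 1)) e x, freeComp_mem _ _ _, by
    rw [map_freeComp _ (P.deg i) _ (P.d_homogeneous i), freeComp_of_mem _ _ _ _ hx, if_pos rfl]⟩

/-- The only homology of `F` is `k`, in homological degree `0` and internal degree `0`; `he`
excludes exactly this spot. -/
lemma exists_homogeneous_of_mem_freeCycles {i : ℕ} {e : ℤ} (he : i = 0 → e ≠ 0)
    {z : P.ι i →₀ S k n} (hz : z ∈ freeCycles P i) (hze : z ∈ freePiece (P.deg i) e) :
    ∃ w ∈ freePiece (P.deg (i + 1)) e, P.d i w = z := by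
  have h : z ∈ Set.range (P.d i) := by
    cases i with
    | zero => exact (P.exact_zero z).1 (P.aug_homogeneous e z hze (he rfl))
    | succ i => exact (P.exact_succ i z).1 hz
  obtain ⟨w, rfl⟩ := h
  exact exists_homogeneous_preimage P hze

/-- `Tor_i(k, J)_j = 0`, for an ideal `J`, in terms of the complex `J F ⊆ F`: the cycles of
degree `j` are boundaries of elements of degree `j`. -/
def Vanishes (J : Ideal (S k n)) (i : ℕ) (j : ℤ) : Prop :=
  ∀ z ∈ freePiece (P.deg i) j, z ∈ coeffIn J (P.ι i) → z ∈ freeCycles P i →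
    ∃ w ∈ freePiece (P.deg (i + 1)) j, w ∈ coeffIn J (P.ι (i + 1)) ∧ P.d i w = z

/-- `Tor_i(k, J)_j ≠ 0`, for an ideal `J`, in terms of the complex `J F ⊆ F`. -/
def Survives (J : Ideal (S k n)) (i : ℕ) (j : ℤ) : Prop :=
  ∃ z ∈ freePiece (P.deg i) j, z ∈ coeffIn J (P.ι i) ∧ z ∈ freeCycles P i ∧
    ∀ w ∈ coeffIn J (P.ι (i + 1)), P.d i w ≠ z

variable {P}

/-- Homogeneous components of a cycle in `J F` are again such cycles; sum their preimages. -/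
lemma Vanishes.exists_preimage {J : Ideal (S k n)} (hJ : IsHomogeneousIdeal J) {i : ℕ}
    (h : ∀ j, Vanishes P J i j) {z : P.ι i →₀ S k n} (hz : z ∈ coeffIn J (P.ι i))
    (hc : z ∈ freeCycles P i) : ∃ w ∈ coeffIn J (P.ι (i + 1)), P.d i w = z := by
  obtain ⟨E, hE⟩ := exists_sum_freeComp (P.deg i) z
  have h' : ∀ e, ∃ w ∈ coeffIn J (P.ι (i + 1)), P.d i w = freeComp (P.deg i) e z := fun e => by
    obtain ⟨w, -, hw⟩ := h e _ (freeComp_mem _ _ _) (hJ.freeComp_mem _ e hz)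
      (freeComp_mem_freeCycles P e hc)
    exact ⟨w, hw⟩
  choose w hw hdw using h'
  refine ⟨∑ e ∈ E, w e, Submodule.sum_mem _ fun e _ => hw e, ?_⟩
  rw [map_sum, Finset.sum_congr rfl fun e _ => hdw e, hE E subset_rfl]

lemma vanishes_bot (i : ℕ) (j : ℤ) : Vanishes P ⊥ i j := fun z _ hz _ => by
  have h : z = 0 := Finsupp.ext fun b => hz b
  exact ⟨0, zero_mem _, zero_mem _, by rw [h, map_zero]⟩

/-- Vanishing of `Tor` passes from `J` and `C = J : u` to `J + (u)`. -/
lemma Vanishes.sup_span_singleton {J C : Ideal (S k n)} (hJ : IsHomogeneousIdeal J) {d : ℤ}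
    {u : S k n} (hu : u ∈ polyPiece k n d) (hC : ∀ s, s ∈ C ↔ u * s ∈ J) {i : ℕ} {j : ℤ}
    (hv : Vanishes P J i j) (h0 : i = 0 → j ≠ d)
    (hc : ∀ l, i = l + 1 → Vanishes P C l (j - d)) :
    Vanishes P (J ⊔ Ideal.span {u}) i j := by
  intro z hzj hz hzc
  obtain ⟨p, hp, hpj, q, hqj, rfl⟩ := exists_homogeneous_add_smul hJ hu _ hz hzj
  -- Correct the splitting `z = p + u q` to `(p + u a) + u (q - a)` with both summands cycles. As `u
  -- dq = -dp` lies in `J F`, the cycle `dq` lies in `C F`, and vanishing for `C` provides `a` with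
  -- `da = dq`.
  obtain ⟨a, ha, haj, hqa⟩ : ∃ a ∈ coeffIn C (P.ι i), a ∈ freePiece (P.deg i) (j - d) ∧
      p + u • a ∈ freeCycles P i ∧ q - a ∈ freeCycles P i := by
    cases i with
    | zero => exact ⟨0, zero_mem _, zero_mem _, trivial, trivial⟩
    | succ l =>
      have h1 : P.d l p + u • P.d l q = 0 := by
        rw [← map_smul, ← map_add]
        exact hzc
      have h2 : P.d l q ∈ coeffIn C (P.ι l) := by
        rw [← smul_mem_coeffIn hC, ← neg_eq_of_add_eq_zero_right h1]
        exact neg_mem (map_mem_coeffIn _ _ hp)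
      obtain ⟨a, haj, ha, hda⟩ := hc l rfl _ (P.d_homogeneous l _ _ hqj) h2
        (d_mem_freeCycles P l q)
      refine ⟨a, ha, haj, ?_, ?_⟩
      · change P.d l _ = 0
        rw [map_add, map_smul, hda, h1]
      · change P.d l _ = 0
        rw [map_sub, hda, sub_self]
  have haj' : u • a ∈ freePiece (P.deg i) j := by
    have := smul_mem_freePiece hu haj
    rwa [sub_add_cancel] at this
  obtain ⟨w, hwj, hw, hdw⟩ := hv (p + u • a) (add_mem hpj haj')
    (add_mem hp ((smul_mem_coeffIn hC).2 ha)) hqa.1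
  obtain ⟨y, hyj, hdy⟩ := exists_homogeneous_of_mem_freeCycles P
    (fun hi => sub_ne_zero.2 (h0 hi)) hqa.2 (sub_mem hqj haj)
  refine ⟨w + u • y, add_mem hwj ?_,
    add_mem (coeffIn_mono le_sup_left _ hw) (smul_mem_coeffIn_sup y), ?_⟩
  · have := smul_mem_freePiece hu hyj
    rwa [sub_add_cancel] at this
  · rw [map_add, map_smul, hdw, hdy, smul_sub]
    abel

/-- A nonzero class of `Tor_i(k, J : u)` gives one of `Tor_{i+1}(k, J + (u))`, if its image in
`Tor_i(k, J)` and in `Tor_i(k, S)` is zero for degree reasons. -/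
lemma Survives.connecting {J C : Ideal (S k n)} {d : ℤ} {u : S k n} (hu : u ∈ polyPiece k n d)
    (hC : ∀ s, s ∈ C ↔ u * s ∈ J) {i : ℕ} {e : ℤ} (hs : Survives P C i e)
    (he : i = 0 → e ≠ 0) (hv : Vanishes P J i (e + d)) :
    Survives P (J ⊔ Ideal.span {u}) (i + 1) (e + d) := by
  obtain ⟨a, hae, ha, hac, hna⟩ := hs
  obtain ⟨p, hpj, hp, hdp⟩ := hv (u • a) (smul_mem_freePiece hu hae) ((smul_mem_coeffIn hC).2 ha)
    (Submodule.smul_mem _ _ hac)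
  obtain ⟨q, hqj, hdq⟩ := exists_homogeneous_of_mem_freeCycles P he hac hae
  -- With `dp = u a` in `J F` and `dq = a` in `F`, this cycle is sent to the class of `a`, up to
  -- sign, by the connecting map.
  refine ⟨p - u • q, sub_mem hpj (smul_mem_freePiece hu hqj),
    sub_mem (coeffIn_mono le_sup_left _ hp) (smul_mem_coeffIn_sup q), ?_, fun w hw hdw => ?_⟩
  · change P.d i _ = 0
    rw [map_sub, map_smul, hdp, hdq, sub_self]
  · obtain ⟨p', hp', q', rfl⟩ := exists_add_smul_of_mem_coeffIn_sup hw
    rw [map_add, map_smul] at hdw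
    -- If `p - u q = d (p' + u q')`, then `u (q + dq') = p - dp'` lies in `J F`. So `q + dq'` lies
    -- in `C F` and has boundary `a`, contrary to the choice of `a`.
    refine hna (q + P.d (i + 1) q') ?_ ?_
    · rw [← smul_mem_coeffIn hC]
      have h : u • (q + P.d (i + 1) q') = p - P.d (i + 1) p' := by
        rw [smul_add, eq_sub_iff_add_eq, add_assoc, add_comm (u • P.d (i + 1) q'), hdw]
        abel
      rw [h]
      exact sub_mem hp (map_mem_coeffIn _ _ hp')
    · rw [map_add, hdq, (P.exact_succ i).apply_apply_eq_zero, add_zero]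

/-- A nonzero class of `Tor_i(k, J)` stays nonzero in `Tor_i(k, J + (u))` if
`Tor_i(k, J : u) = 0`. -/
lemma Survives.sup_span_singleton {J C : Ideal (S k n)} {u : S k n}
    (hC : ∀ s, s ∈ C ↔ u * s ∈ J) (hCh : IsHomogeneousIdeal C) {i : ℕ} {e : ℤ}
    (hs : Survives P J i e) (hv : ∀ j, Vanishes P C i j) :
    Survives P (J ⊔ Ideal.span {u}) i e := by
  obtain ⟨z, hze, hz, hzc, hnz⟩ := hs
  refine ⟨z, hze, coeffIn_mono le_sup_left _ hz, hzc, fun w hw hdw => ?_⟩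
  obtain ⟨p, hp, q, rfl⟩ := exists_add_smul_of_mem_coeffIn_sup hw
  rw [map_add, map_smul] at hdw
  -- A bounding chain `p + u q` over `J + (u)` can be moved into `J F`: replace `q` by some `a` in
  -- `C F` with the same boundary.
  have h : P.d i q ∈ coeffIn C (P.ι i) := by
    rw [← smul_mem_coeffIn hC, ← sub_eq_of_eq_add' hdw.symm]
    exact sub_mem hz (map_mem_coeffIn _ _ hp)
  obtain ⟨a, ha, hda⟩ := Vanishes.exists_preimage hCh hv h (d_mem_freeCycles P i q)
  refine hnz (p + u • a) (add_mem hp ((smul_mem_coeffIn hC).2 ha)) ?_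
  rw [map_add, map_smul, hda, hdw]

variable (P) in
/-- The class of a generator in `Tor_0` of a principal ideal. -/
lemma survives_span_singleton {u : S k n} (hu0 : u ≠ 0) {d : ℤ} (hu : u ∈ polyPiece k n d) :
    Survives P (Ideal.span {u}) 0 d := by
  -- The augmentation kills all nonzero degrees and is onto `k ≠ 0`. The class will be `u x`: were
  -- it a boundary `d (u q)`, cancelling `u` would give `x = dq` and `aug x = 0`.
  obtain ⟨x, hx0, hx⟩ : ∃ x ∈ freePiece (P.deg 0) 0, P.aug x ≠ 0 := by
    by_contra! h
    obtain ⟨y, hy⟩ := P.aug_surjective (Submodule.Quotient.mk 1)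
    have hz : ∀ y, P.aug y = 0 := fun y => by
      induction y using free_induction (P.deg 0) with
      | h0 => exact map_zero _
      | hadd x y hx hy => rw [map_add, hx, hy, add_zero]
      | hhom e x hx =>
        by_cases he : e = 0
        · exact h x (he ▸ hx)
        · exact P.aug_homogeneous e x hx he
    rw [hz y, eq_comm, Submodule.Quotient.mk_eq_zero, ← pow_one (idealOfVars (Fin n) k),
      mem_pow_idealOfVars_iff'] at hy
    simpa using hy 0
  refine ⟨u • x, ?_, fun _ => Ideal.mul_mem_right _ _ (Ideal.mem_span_singleton_self u), trivial,
    fun w hw hdw => hx ?_⟩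
  · have := smul_mem_freePiece hu hx0
    rwa [zero_add] at this
  · have hw' : w ∈ coeffIn (⊥ ⊔ Ideal.span {u}) (P.ι 1) := by rwa [bot_sup_eq]
    obtain ⟨p, hp, q, rfl⟩ := exists_add_smul_of_mem_coeffIn_sup hw'
    have hp0 : p = 0 := Finsupp.ext fun b => hp b
    rw [map_add, hp0, map_zero, zero_add, map_smul] at hdw
    rw [← smul_right_injective _ hu0 hdw]
    exact (P.exact_zero).apply_apply_eq_zero q

end CoefficientSubcomplexes

/-! ### Monomial ideals, ideals of variables, linear quotients -/

section MonomialIdeals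

variable (k : Type u) [Field k] {n : ℕ}

/-- The monomial ideal generated by the monomials with exponents in `A`. -/
noncomputable def monomialIdeal (A : Set (Fin n →₀ ℕ)) : Ideal (S k n) :=
  Ideal.span ((fun s => monomial s (1 : k)) '' A)

variable {k}

lemma mem_monomialIdeal {A : Set (Fin n →₀ ℕ)} {p : S k n} :
    p ∈ monomialIdeal k A ↔ ∀ m ∈ p.support, ∃ a ∈ A, a ≤ m :=
  mem_ideal_span_monomial_image

lemma isHomogeneousIdeal_monomialIdeal (A : Set (Fin n →₀ ℕ)) :
    IsHomogeneousIdeal (monomialIdeal k A) := by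
  classical
  intro p hp e
  rw [mem_monomialIdeal] at hp ⊢
  refine fun m hm => hp m ?_
  rw [mem_support_iff, coeff_weightedHomogeneousComponent] at hm
  exact mem_support_iff.2 fun h => hm (by rw [h, ite_self])

lemma monomialIdeal_insert (A : Set (Fin n →₀ ℕ)) (s : Fin n →₀ ℕ) :
    monomialIdeal k (insert s A) = monomialIdeal k A ⊔ Ideal.span {monomial s (1 : k)} := by
  rw [monomialIdeal, Set.image_insert_eq, Ideal.span_insert, sup_comm, monomialIdeal]

lemma monomialIdeal_empty : monomialIdeal k (∅ : Set (Fin n →₀ ℕ)) = ⊥ := by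
  simp [monomialIdeal]

/-- Multiplication by `x^s` translates supports by `s`, so a colon by a monomial can be checked on
exponents. -/
lemma mem_monomialIdeal_iff_monomial_mul_mem {A C : Set (Fin n →₀ ℕ)} {s : Fin n →₀ ℕ}
    (h : ∀ m, (∃ c ∈ C, c ≤ m) ↔ ∃ a ∈ A, a ≤ s + m) (p : S k n) :
    p ∈ monomialIdeal k C ↔ monomial s (1 : k) * p ∈ monomialIdeal k A := by
  rw [mem_monomialIdeal, mem_monomialIdeal]
  constructor
  · intro hp m hm
    rw [mem_support_iff, coeff_monomial_mul'] at hm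
    obtain ⟨l, rfl⟩ : ∃ l, m = s + l := le_iff_exists_add.1 (by by_contra hc; simp [hc] at hm)
    refine (h l).1 (hp l (mem_support_iff.2 fun h0 => hm ?_))
    simp [h0]
  · intro hp m hm
    refine (h m).2 (hp _ ?_)
    rw [mem_support_iff, coeff_monomial_mul, one_mul]
    exact mem_support_iff.1 hm

variable (k) in
/-- The ideal generated by the variables with indices in `T`. -/
noncomputable def variablesIdeal (T : Finset (Fin n)) : Ideal (S k n) :=
  monomialIdeal k ((fun i => Finsupp.single i 1) '' (T : Set (Fin n)))

lemma exists_single_le_iff {T : Finset (Fin n)} {m : Fin n →₀ ℕ} :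
    (∃ c ∈ (fun i => Finsupp.single i 1) '' (T : Set (Fin n)), c ≤ m) ↔ ∃ i ∈ T, m i ≠ 0 := by
  simp [Nat.one_le_iff_ne_zero]

lemma variablesIdeal_insert [DecidableEq (Fin n)] (T : Finset (Fin n)) (i : Fin n) :
    variablesIdeal k (insert i T) =
      variablesIdeal k T ⊔ Ideal.span {monomial (Finsupp.single i 1) (1 : k)} := by
  rw [variablesIdeal, Finset.coe_insert, Set.image_insert_eq, monomialIdeal_insert, variablesIdeal]

lemma mem_variablesIdeal_iff_X_mul_mem {T : Finset (Fin n)} {i : Fin n} (hi : i ∉ T) (p : S k n) :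
    p ∈ variablesIdeal k T ↔ monomial (Finsupp.single i 1) (1 : k) * p ∈ variablesIdeal k T := by
  refine mem_monomialIdeal_iff_monomial_mul_mem (fun m => ?_) p
  rw [exists_single_le_iff, exists_single_le_iff]
  refine exists_congr fun j => and_congr_right fun hj => ?_
  rw [Finsupp.add_apply, Finsupp.single_eq_of_ne (ne_of_mem_of_not_mem hj hi), zero_add]

lemma monomial_single_mem_polyPiece (i : Fin n) :
    monomial (Finsupp.single i 1) (1 : k) ∈ polyPiece k n 1 :=
  isWeightedHomogeneous_X k (fun _ : Fin n => (1 : ℤ)) i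

variable (P : GradedFreeResolution k n)

/-- Variables form a regular sequence: a new variable has colon `(T) : x_a = (T)`, so both terms of
the colon sequence are covered by induction. -/
lemma vanishes_variablesIdeal (T : Finset (Fin n)) {i : ℕ} {j : ℤ}
    (h : (i : ℤ) + 1 < j ∨ T.card ≤ i) : Vanishes P (variablesIdeal k T) i j := by
  classical
  induction T using Finset.induction_on generalizing i j with
  | empty =>
    simp only [variablesIdeal, Finset.coe_empty, Set.image_empty, monomialIdeal_empty]
    exact vanishes_bot i j
  | insert a T ha ih =>
    rw [Finset.card_insert_of_notMem ha] at h
    rw [variablesIdeal_insert]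
    refine Vanishes.sup_span_singleton (isHomogeneousIdeal_monomialIdeal _)
      (monomial_single_mem_polyPiece a) (mem_variablesIdeal_iff_X_mul_mem ha)
      (ih (by omega)) (by omega) fun l hl => ih (by omega)

/-- This is the top Koszul class, built by one connecting map for each variable after the first. -/
lemma survives_variablesIdeal (T : Finset (Fin n)) (c : ℕ) (hT : T.card = c + 1) :
    Survives P (variablesIdeal k T) c ((c + 1 : ℕ) : ℤ) := by
  classical
  induction T using Finset.induction_on generalizing c with
  | empty => simp at hT
  | insert a T ha ih =>
    rw [Finset.card_insert_of_notMem ha, add_left_inj] at hT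
    rw [variablesIdeal_insert]
    cases c with
    | zero =>
      rw [Finset.card_eq_zero] at hT
      simp only [variablesIdeal, hT, Finset.coe_empty, Set.image_empty, monomialIdeal_empty,
        bot_sup_eq]
      exact survives_span_singleton P (by simp) (monomial_single_mem_polyPiece a)
    | succ c =>
      exact (ih c hT).connecting (monomial_single_mem_polyPiece a)
        (mem_variablesIdeal_iff_X_mul_mem ha) (by omega) (vanishes_variablesIdeal P T (by omega))

/-- `Tor(k, J)` for a monomial ideal `J` with linear quotients: the generators `x ^ s a`, `a ∈ G`,
have the same degree `D`, and the colon ideal of each by the preceding ones is generated by the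
variables with indices in `T a`. Here `M > 0` is the maximal number of these variables. -/
theorem vanishes_and_survives_of_linear_quotients {α : Type*} [LinearOrder α] (G : Finset α)
    (s : α → Fin n →₀ ℕ) (D : ℤ) (hD : ∀ a ∈ G, monomial (s a) (1 : k) ∈ polyPiece k n D)
    (T : α → Finset (Fin n))
    (hT : ∀ a ∈ G, ∀ m, (∃ i ∈ T a, m i ≠ 0) ↔ ∃ b ∈ G, b < a ∧ s b ≤ s a + m)
    (M : ℕ) (hM : M ≠ 0) (hle : ∀ a ∈ G, (T a).card ≤ M) (hex : ∃ a ∈ G, (T a).card = M) :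
    (∀ (i : ℕ) (j : ℤ), i + D < j ∨ M < i →
      Vanishes P (monomialIdeal k (s '' (G : Set α))) i j) ∧
      Survives P (monomialIdeal k (s '' (G : Set α))) M (M + D) := by
  classical
  -- Induct over initial segments `H` of `G`: only for these is the colon at the next generator `a`
  -- the one described by `T a`.
  suffices h : ∀ H : Finset α, H ⊆ G → (∀ a ∈ H, ∀ b ∈ G, b < a → b ∈ H) →
      (∀ (i : ℕ) (j : ℤ), i + D < j ∨ M < i →
        Vanishes P (monomialIdeal k (s '' (H : Set α))) i j) ∧
      ((∃ a ∈ H, (T a).card = M) →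
        Survives P (monomialIdeal k (s '' (H : Set α))) M (M + D)) from
    ⟨(h G subset_rfl fun _ _ b hb _ => hb).1, (h G subset_rfl fun _ _ b hb _ => hb).2 hex⟩
  intro H
  induction H using Finset.induction_on_max with
  | empty =>
    intro _ _
    simp only [Finset.coe_empty, Set.image_empty, monomialIdeal_empty]
    exact ⟨fun i j _ => vanishes_bot i j, by simp⟩
  | insert a H hH ih =>
    intro hG hI
    have haG : a ∈ G := hG (Finset.mem_insert_self a H)
    have hHG : H ⊆ G := (Finset.subset_insert a H).trans hG
    have hlt : ∀ b, b ∈ H ↔ b ∈ G ∧ b < a := fun b => by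
      refine ⟨fun hb => ⟨hHG hb, hH b hb⟩, fun hb => ?_⟩
      exact Finset.mem_of_mem_insert_of_ne (hI a (Finset.mem_insert_self a H) b hb.1 hb.2) hb.2.ne
    obtain ⟨hv, hs⟩ := ih hHG fun b hb c hc hcb => (hlt c).2 ⟨hc, hcb.trans (hH b hb)⟩
    have hcol : ∀ p, p ∈ variablesIdeal k (T a) ↔
        monomial (s a) (1 : k) * p ∈ monomialIdeal k (s '' (H : Set α)) :=
      mem_monomialIdeal_iff_monomial_mul_mem fun m => by
        rw [exists_single_le_iff, hT a haG]
        simp [hlt, and_assoc]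
    have hca := hle a haG
    rw [Finset.coe_insert, Set.image_insert_eq, monomialIdeal_insert]
    refine ⟨fun i j hij => ?_, fun hex => ?_⟩
    · exact (hv i j hij).sup_span_singleton (isHomogeneousIdeal_monomialIdeal _) (hD a haG) hcol
        (by omega) fun l hl => vanishes_variablesIdeal P _ (by omega)
    -- A class already present persists, since `Tor_M` of the new colon ideal vanishes. Otherwise
    -- `a` is the first generator with `M` colon variables, and its top Koszul class in `Tor_{M-1}`
    -- is lifted by the connecting map; this is where `M ≠ 0` enters.
    · by_cases hb : ∃ b ∈ H, (T b).card = M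
      · exact (hs hb).sup_span_singleton hcol (isHomogeneousIdeal_monomialIdeal _)
          fun j => vanishes_variablesIdeal P _ (Or.inr hca)
      · obtain ⟨c, rfl⟩ := Nat.exists_eq_succ_of_ne_zero hM
        have hc : (T a).card = c + 1 := by
          obtain ⟨b, hbH, hbc⟩ := hex
          rcases Finset.mem_insert.1 hbH with rfl | hbH
          · exact hbc
          · exact absurd ⟨b, hbH, hbc⟩ hb
        exact (survives_variablesIdeal P _ c hc).connecting (hD a haG) hcol (by omega)
          (hv _ _ (by push_cast; omega))

end MonomialIdeals

/-! ### Monomial generators of the powers of the path ideal -/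

section PathIdeals

variable (k : Type u) [Field k] {n : ℕ}

lemma val_finRotate_pow (j : ℕ) (i : Fin (n + 1)) :
    ((finRotate (n + 1) ^ j) i : ℕ) = (i + j) % (n + 1) := by
  induction j with
  | zero => simp [Nat.mod_eq_of_lt i.2]
  | succ j ih =>
    rw [pow_succ', Equiv.Perm.mul_apply, finRotate_apply, Fin.val_add, ih, Fin.val_one',
      ← Nat.add_mod, add_assoc]

lemma exists_eq_add_single {a : Fin n → ℕ} {i : Fin n} (h : a i ≠ 0) :
    ∃ c : Fin n → ℕ, a = c + Pi.single i 1 := by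
  refine ⟨a - Pi.single i 1, (tsub_add_cancel_of_le fun j => ?_).symm⟩
  rw [Pi.single_apply]
  split_ifs with hj
  · exact Nat.one_le_iff_ne_zero.2 (hj ▸ h)
  · exact Nat.zero_le _

/-- The rotations by `0, …, n` take distinct values at `i`, so the first `n` of them miss only the
last one. -/
lemma image_finRotate_pow (i : Fin (n + 1)) :
    (Finset.range n).image (fun j => (finRotate (n + 1) ^ j) i) =
      Finset.univ.erase ((finRotate (n + 1) ^ n) i) ∧
    Set.InjOn (fun j => (finRotate (n + 1) ^ j) i) (Finset.range (n + 1)) := by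
  have hinj : Set.InjOn (fun j => (finRotate (n + 1) ^ j) i) (Finset.range (n + 1)) := by
    intro a ha b hb hab
    rw [Finset.coe_range, Set.mem_Iio] at ha hb
    have h := congrArg Fin.val hab
    simp only [val_finRotate_pow] at h
    exact Nat.ModEq.eq_of_lt_of_lt (Nat.ModEq.add_left_cancel' (i : ℕ) h) ha hb
  refine ⟨Finset.eq_of_subset_of_card_le ?_ ?_, hinj⟩
  · intro l hl
    obtain ⟨j, hj, rfl⟩ := Finset.mem_image.1 hl
    rw [Finset.mem_range] at hj
    refine Finset.mem_erase.2 ⟨fun h => hj.ne (hinj ?_ ?_ h), Finset.mem_univ _⟩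
    · simpa using hj.le
    · simp
  · rw [Finset.card_image_of_injOn (hinj.mono ?_), Finset.card_range,
      Finset.card_erase_of_mem (Finset.mem_univ _), Finset.card_univ, Fintype.card_fin,
      Nat.add_sub_cancel]
    intro j hj
    simp only [Finset.coe_range, Set.mem_Iio] at hj ⊢
    omega

lemma cyclePathIdeal_eq_monomialIdeal :
    cyclePathIdeal k (n + 1) n = monomialIdeal k {s | ∃ i, s + Finsupp.single i 1 =
      Finsupp.equivFunOnFinite.symm fun _ => 1} := by
  have hprod : ∀ i : Fin (n + 1),
      ∏ j ∈ Finset.range n, (X ((finRotate (n + 1) ^ j) i) : S k (n + 1)) =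
        monomial (∑ l ∈ Finset.univ.erase ((finRotate (n + 1) ^ n) i), Finsupp.single l 1) 1 := by
    intro i
    obtain ⟨himg, hinj⟩ := image_finRotate_pow i
    rw [← himg, Finset.sum_image (hinj.mono (by simp)), monomial_sum_one]
    rfl
  have hsum : ∀ l : Fin (n + 1), ∑ j ∈ Finset.univ.erase l, Finsupp.single j 1 +
      Finsupp.single l 1 = (Finsupp.equivFunOnFinite.symm fun _ => 1 : Fin (n + 1) →₀ ℕ) := by
    intro l
    rw [Finset.sum_erase_add _ _ (Finset.mem_univ l)]
    ext j
    simp [Finsupp.finsetSum_apply, Finsupp.single_apply]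
  rw [cyclePathIdeal, monomialIdeal]
  congr 1
  ext p
  constructor
  · rintro ⟨i, rfl⟩
    exact ⟨_, ⟨_, hsum _⟩, (hprod i).symm⟩
  · rintro ⟨s, ⟨l, hl⟩, rfl⟩
    refine ⟨(finRotate (n + 1) ^ n).symm l, ?_⟩
    dsimp only
    rw [hprod, Equiv.apply_symm_apply, add_right_cancel ((hsum l).trans hl.symm)]

lemma cyclePathIdeal_pow_eq_monomialIdeal (t : ℕ) : cyclePathIdeal k (n + 1) n ^ t =
    monomialIdeal k {s | ∃ a : Fin (n + 1) → ℕ, ∑ i, a i = t ∧ ∀ i, s i + a i = t} := by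
  induction t with
  | zero =>
    rw [pow_zero, eq_comm, Ideal.one_eq_top, Ideal.eq_top_iff_one, mem_monomialIdeal]
    exact fun m _ => ⟨0, ⟨0, by simp, by simp⟩, zero_le⟩
  | succ t ih =>
    rw [pow_succ, ih, cyclePathIdeal_eq_monomialIdeal, monomialIdeal, monomialIdeal,
      Ideal.span_mul_span', monomialIdeal]
    congr 1
    ext p
    rw [Set.mem_mul]
    constructor
    · rintro ⟨_, ⟨s, ⟨a, ha, hsa⟩, rfl⟩, _, ⟨r, ⟨l, hl⟩, rfl⟩, rfl⟩
      refine ⟨s + r, ⟨a + Pi.single l 1, ?_, fun i => ?_⟩, ?_⟩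
      · simp [Finset.sum_add_distrib, ha]
      · have h1 := DFunLike.congr_fun hl i
        have h2 := hsa i
        rw [Finsupp.add_apply, Finsupp.single_apply, Finsupp.equivFunOnFinite_symm_apply_apply] at h1
        rw [Finsupp.add_apply, Pi.add_apply, Pi.single_apply]
        simp only [eq_comm (a := i) (b := l)]
        omega
      · simp [monomial_mul]
    · rintro ⟨s, ⟨a, ha, hsa⟩, rfl⟩
      -- Split off one factor: with `a = b + e_l`, `x^(t+1) / x^a = (x^t / x^b) (x / x_l)`.
      obtain ⟨l, hl⟩ : ∃ l, a l ≠ 0 := by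
        by_contra! h
        simp [h] at ha
      obtain ⟨b, rfl⟩ := exists_eq_add_single hl
      have hb : ∑ i, b i = t := by simpa [Finset.sum_add_distrib] using ha
      have hbt : ∀ i, b i ≤ t := fun i =>
        hb ▸ Finset.single_le_sum (fun _ _ => Nat.zero_le _) (Finset.mem_univ i)
      have h1 : ∀ i, (Pi.single l 1 : Fin (n + 1) → ℕ) i ≤ 1 := fun i => by
        rw [Pi.single_apply]
        split_ifs <;> simp
      let f : Fin (n + 1) →₀ ℕ := Finsupp.equivFunOnFinite.symm fun i => t - b i
      let g : Fin (n + 1) →₀ ℕ :=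
        Finsupp.equivFunOnFinite.symm fun i => 1 - (Pi.single l 1 : Fin (n + 1) → ℕ) i
      have hf : ∀ i, f i = t - b i := fun _ => rfl
      have hg : ∀ i, g i = 1 - (Pi.single l 1 : Fin (n + 1) → ℕ) i := fun _ => rfl
      have hfg : f + g = s := by
        ext i
        have h2 := hsa i
        have h3 := h1 i
        have h4 := hbt i
        rw [Pi.add_apply] at h2
        rw [Finsupp.add_apply, hf, hg]
        omega
      refine ⟨monomial f 1, ⟨f, ⟨b, hb, fun i => ?_⟩, rfl⟩, monomial g 1, ⟨g, ⟨l, ?_⟩, rfl⟩, ?_⟩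
      · rw [hf, Nat.sub_add_cancel (hbt i)]
      · ext i
        rw [Finsupp.add_apply, hg, Finsupp.single_eq_pi_single]
        exact Nat.sub_add_cancel (h1 i)
      · simp [monomial_mul, hfg]

end PathIdeals

/-! ### From the subcomplex `J F` back to Tor, projective dimension and regularity -/

section BettiNumbers

variable {k : Type u} [Field k] {n : ℕ} (P : GradedFreeResolution k n) (J : Ideal (S k n))

/-- The inclusion of `F i ⊗ J` into `F i`. -/
noncomputable def chainToFree (i : ℕ) : chain P J i →ₗ[S k n] (P.ι i →₀ S k n) :=
  (TensorProduct.rid (S k n) (P.F i)).toLinearMap ∘ₗ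
    J.subtype.lTensor (P.F i)

lemma chainToFree_tmul (i : ℕ) (f : P.ι i →₀ S k n) (p : J) :
    chainToFree P J i ((show P.F i from f) ⊗ₜ p) = (p : S k n) • f := by
  exact TensorProduct.rid_tmul (R := S k n) (M := P.F i) f (p : S k n)

lemma chainToFree_injective (i : ℕ) : Function.Injective (chainToFree P J i) := by
  have : Module.Free (S k n) (P.F i) := inferInstanceAs (Module.Free (S k n) (P.ι i →₀ S k n))
  exact (TensorProduct.rid (S k n) (P.F i)).injective.comp
    (Module.Flat.lTensor_preserves_injective_linearMap J.subtype Subtype.val_injective)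

lemma chainToFree_mem (i : ℕ) (z : chain P J i) : chainToFree P J i z ∈ coeffIn J (P.ι i) := by
  induction z using TensorProduct.induction_on with
  | zero => rw [map_zero]; exact zero_mem _
  | add x y hx hy => rw [map_add]; exact add_mem hx hy
  | tmul f p =>
    rw [chainToFree_tmul P J i f p]
    exact fun b => J.mul_mem_right _ p.2

lemma chainToFree_differential (i : ℕ) (z : chain P J (i + 1)) :
    chainToFree P J i (differential P J i z) = P.d i (chainToFree P J (i + 1) z) := by
  induction z using TensorProduct.induction_on with
  | zero => simp only [map_zero]
  | add x y hx hy => simp only [map_add, hx, hy]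
  | tmul f p =>
    exact (chainToFree_tmul P J i (P.d i f) p).trans
      ((map_smul (P.d i) (p : S k n) f).symm.trans
        (congrArg (P.d i) (chainToFree_tmul P J (i + 1) f p).symm))

/-- Expanding `f` in the basis gives a preimage `∑ e_b ⊗ f_b`, which is homogeneous whenever `f` is.
-/
lemma exists_chainToFree_eq (i : ℕ) {f : P.ι i →₀ S k n} (hf : f ∈ coeffIn J (P.ι i)) :
    ∃ z : chain P J i, chainToFree P J i z = f ∧
      ∀ j, f ∈ freePiece (P.deg i) j → z ∈ chainPiece P (idealPiece J) i j := by
  classical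
  refine ⟨∑ b ∈ f.support,
    (show P.F i from Finsupp.single b 1) ⊗ₜ (⟨f b, hf b⟩ : J), ?_, fun j hj => ?_⟩
  · rw [map_sum]
    conv_rhs => rw [← Finsupp.sum_single f, Finsupp.sum]
    refine Finset.sum_congr rfl fun b _ => ?_
    rw [chainToFree_tmul, Finsupp.smul_single, smul_eq_mul, mul_one]
  · refine Submodule.sum_mem _ fun b _ => Submodule.subset_span
      ⟨P.deg i b, j - P.deg i b, by ring, _, fun c => ?_, _, hj b, rfl⟩
    by_cases hc : b = c
    · subst hc
      rw [Finsupp.single_eq_same, sub_self]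
      exact isWeightedHomogeneous_one k _
    · rw [Finsupp.single_eq_of_ne' hc]
      exact zero_mem _

lemma chainToFree_mem_freePiece {i : ℕ} {j : ℤ} {z : chain P J i}
    (hz : z ∈ chainPiece P (idealPiece J) i j) :
    chainToFree P J i z ∈ freePiece (P.deg i) j := by
  induction hz using Submodule.span_induction with
  | zero => rw [map_zero]; exact zero_mem _
  | add x y _ _ hx hy => rw [map_add]; exact add_mem hx hy
  | smul c x _ hx =>
    rw [← algebraMap_smul (S k n) c x, map_smul, algebraMap_smul]
    exact Submodule.smul_mem _ c hx
  | mem z hz =>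
    obtain ⟨a, b, rfl, f, hf, p, hp, rfl⟩ := hz
    rw [chainToFree_tmul P J i f p]
    exact smul_mem_freePiece hp hf

lemma mem_cycles_iff (i : ℕ) (z : chain P J i) :
    z ∈ cycles P J i ↔ chainToFree P J i z ∈ freeCycles P i := by
  cases i with
  | zero => exact Iff.rfl
  | succ i =>
    change differential P J i z = 0 ↔ P.d i _ = 0
    rw [← chainToFree_differential, map_eq_zero_iff _ (chainToFree_injective P J i)]

lemma mem_boundaries_iff (i : ℕ) (z : chain P J i) :
    z ∈ boundaries P J i ↔ ∃ w ∈ coeffIn J (P.ι (i + 1)), P.d i w = chainToFree P J i z := by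
  constructor
  · rintro ⟨w, rfl⟩
    exact ⟨_, chainToFree_mem P J (i + 1) w, (chainToFree_differential P J i w).symm⟩
  · rintro ⟨w, hw, hdw⟩
    obtain ⟨y, rfl, -⟩ := exists_chainToFree_eq P J (i + 1) hw
    exact ⟨y, chainToFree_injective P J i (by rw [chainToFree_differential, hdw])⟩

variable {J}

lemma subsingleton_tor (hJ : IsHomogeneousIdeal J) {i : ℕ} (h : ∀ j, Vanishes P J i j) :
    Subsingleton (Tor P J i) := by
  rw [Submodule.Quotient.subsingleton_iff, eq_top_iff]
  rintro ⟨z, hz⟩ -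
  refine (mem_boundaries_iff P J i z).2 ?_
  exact Vanishes.exists_preimage hJ h (chainToFree_mem P J i z) ((mem_cycles_iff P J i z).1 hz)

lemma Vanishes.torPiece_eq_bot {i : ℕ} {j : ℤ} (h : Vanishes P J i j) :
    torPiece P (idealPiece J) i j = ⊥ := by
  rw [eq_bot_iff]
  rintro _ ⟨⟨z, hz⟩, hzj, rfl⟩
  refine (Submodule.Quotient.mk_eq_zero _).2 ?_
  refine (mem_boundaries_iff P J i z).2 ?_
  obtain ⟨w, -, hw⟩ := h _ (chainToFree_mem_freePiece P J hzj) (chainToFree_mem P J i z)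
    ((mem_cycles_iff P J i z).1 hz)
  exact ⟨w, hw⟩

lemma Survives.torPiece_ne_bot {i : ℕ} {j : ℤ} (h : Survives P J i j) :
    torPiece P (idealPiece J) i j ≠ ⊥ := by
  obtain ⟨f, hfj, hf, hfc, hn⟩ := h
  obtain ⟨z, rfl, hz⟩ := exists_chainToFree_eq P J i hf
  intro hbot
  have h0 := (Submodule.eq_bot_iff _).1 hbot _
    ⟨⟨z, (mem_cycles_iff P J i z).2 hfc⟩, hz j hfj, rfl⟩
  have h1 := (Submodule.Quotient.mk_eq_zero _).1 h0
  replace h1 := (mem_boundaries_iff P J i z).1 h1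
  obtain ⟨w, hw, hdw⟩ := h1
  exact hn w hw hdw

/-- An ideal whose graded Betti numbers vanish for `j > i + D` and for `i > M`, and whose Betti
number `β_{M,M+D}` does not vanish. -/
theorem idealProjDim_eq_and_idealRegularity_eq (hJ : IsHomogeneousIdeal J) {M : ℕ} {D : ℤ}
    (hv : ∀ (i : ℕ) (j : ℤ), i + D < j ∨ M < i → Vanishes (canonicalResolution k n) J i j)
    (hs : Survives (canonicalResolution k n) J M (M + D)) :
    idealProjDim J = ((M : ℕ∞) : WithBot ℕ∞) ∧
      idealRegularity J = ((D : WithTop ℤ) : WithBot (WithTop ℤ)) := by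
  have hne := hs.torPiece_ne_bot
  constructor
  · apply le_antisymm
    · refine sSup_le ?_
      rintro _ ⟨i, hi, rfl⟩
      by_contra hlt
      have hMi : M < i := by
        by_contra hle
        exact hlt (by exact_mod_cast not_lt.1 hle)
      exact hi (rank_zero_iff.2 (subsingleton_tor _ hJ fun j => hv i j (Or.inr hMi)))
    -- If all of `Tor_M` were zero, so would be its nonzero piece of degree `M + D`.
    · refine le_sSup ⟨M, fun h0 => hne ?_, rfl⟩
      have := rank_zero_iff.1 h0
      exact Submodule.eq_bot_of_subsingleton
  · apply le_antisymm
    · refine sSup_le ?_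
      rintro _ ⟨i, j, hij, rfl⟩
      by_contra hlt
      have hD : i + D < j := by
        by_contra hle
        have : j - i ≤ D := by omega
        exact hlt (by exact_mod_cast this)
      exact hij (by rw [gradedBetti, (hv i j (Or.inl hD)).torPiece_eq_bot, rank_bot])
    · refine le_sSup ⟨M, M + D, fun h0 => hne ?_, by rw [add_sub_cancel_left]⟩
      exact Submodule.rank_eq_zero.1 h0

end BettiNumbers

/-! ### Lexicographic linear quotients of the powers -/

section LinearQuotients

variable {n : ℕ}

/-- The exponent of the generator `(x₀ ⋯ xₙ) ^ t / x ^ a`. -/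
noncomputable def complementExponent (t : ℕ) (a : Lex (Fin (n + 1) → ℕ)) : Fin (n + 1) →₀ ℕ :=
  Finsupp.equivFunOnFinite.symm fun i => t - ofLex a i

lemma complementExponent_apply (t : ℕ) (a : Lex (Fin (n + 1) → ℕ)) (i : Fin (n + 1)) :
    complementExponent t a i = t - ofLex a i := rfl

/-- The exponents of total degree `t`, with the lexicographic order. -/
noncomputable def lexExponents (n t : ℕ) : Finset (Lex (Fin (n + 1) → ℕ)) :=
  (Finset.piAntidiag Finset.univ t).map toLex.toEmbedding

lemma mem_lexExponents {t : ℕ} {a : Lex (Fin (n + 1) → ℕ)} :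
    a ∈ lexExponents n t ↔ ∑ i, ofLex a i = t := by
  rw [lexExponents, Finset.mem_map_equiv, Finset.mem_piAntidiag]
  exact and_iff_left fun i _ => Finset.mem_univ i

lemma le_of_mem_lexExponents {t : ℕ} {a : Lex (Fin (n + 1) → ℕ)} (ha : a ∈ lexExponents n t)
    (i : Fin (n + 1)) : ofLex a i ≤ t :=
  mem_lexExponents.1 ha ▸ Finset.single_le_sum (fun _ _ => Nat.zero_le _) (Finset.mem_univ i)

/-- The variables that generate the colon ideal of the generator `(x₀ ⋯ xₙ) ^ t / x ^ a` by the
preceding ones. -/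
def colonVariables (a : Lex (Fin (n + 1) → ℕ)) : Finset (Fin (n + 1)) :=
  (Finset.univ.erase (Fin.last n)).filter fun i => ofLex a i ≠ 0

lemma mem_colonVariables {a : Lex (Fin (n + 1) → ℕ)} {i : Fin (n + 1)} :
    i ∈ colonVariables a ↔ i ≠ Fin.last n ∧ ofLex a i ≠ 0 := by
  rw [colonVariables, Finset.mem_filter, Finset.mem_erase, and_iff_left (Finset.mem_univ i)]

/-- The last index is never counted, and each counted index contributes at least `1` to `|a| = t`.
-/
lemma card_colonVariables_le {t : ℕ} {a : Lex (Fin (n + 1) → ℕ)} (ha : a ∈ lexExponents n t) :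
    (colonVariables a).card ≤ min n t := by
  refine le_min ?_ ?_
  · refine (Finset.card_filter_le _ _).trans ?_
    simp
  · rw [← mem_lexExponents.1 ha, Finset.card_eq_sum_ones]
    refine (Finset.sum_le_sum fun i hi => ?_).trans
      (Finset.sum_le_sum_of_subset (Finset.subset_univ (colonVariables a)))
    exact Nat.one_le_iff_ne_zero.2 (mem_colonVariables.1 hi).2

lemma exists_card_colonVariables_eq (n t : ℕ) :
    ∃ a ∈ lexExponents n t, (colonVariables a).card = min n t := by
  set m := min n t with hm
  -- Put `1` on the first `m` indices and the remaining `t - m` on the last, which is not among them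
  -- because `m ≤ n`.
  refine ⟨toLex fun i => (if i = Fin.last n then t - m else 0) + if (i : ℕ) < m then 1 else 0,
    ?_, ?_⟩
  · rw [mem_lexExponents]
    simp only [ofLex_toLex, Finset.sum_add_distrib, Finset.sum_ite_eq', Finset.mem_univ, if_true,
      Finset.sum_boole, Fin.card_filter_val_lt, Nat.cast_id]
    omega
  · have h : colonVariables (toLex fun i : Fin (n + 1) =>
        (if i = Fin.last n then t - m else 0) + if (i : ℕ) < m then 1 else 0) =
        Finset.univ.filter fun i : Fin (n + 1) => (i : ℕ) < m := by
      ext i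
      rw [mem_colonVariables, Finset.mem_filter, Fin.ext_iff.ne, Fin.val_last]
      simp only [ofLex_toLex, Finset.mem_univ, true_and]
      by_cases hi : i = Fin.last n
      · simp [hi, hm]
      · have : (i : ℕ) ≠ n := fun h => hi (Fin.ext h)
        simp [hi, this]
    rw [h, Fin.card_filter_val_lt]
    omega

lemma exists_mem_colonVariables_iff {t : ℕ} {a : Lex (Fin (n + 1) → ℕ)}
    (ha : a ∈ lexExponents n t) (m : Fin (n + 1) →₀ ℕ) :
    (∃ i ∈ colonVariables a, m i ≠ 0) ↔
      ∃ b ∈ lexExponents n t, b < a ∧ complementExponent t b ≤ complementExponent t a + m := by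
  constructor
  · rintro ⟨i, hi, hmi⟩
    obtain ⟨hil, hai⟩ := mem_colonVariables.1 hi
    obtain ⟨c, hc⟩ := exists_eq_add_single hai
    -- Move one unit of `a` from `i` to the last index. The first change is a decrease at `i`, and
    -- the complementary exponent grows only at `i`, by `1 ≤ m i`.
    refine ⟨toLex (c + Pi.single (Fin.last n) 1), ?_, ⟨i, fun j hj => ?_, ?_⟩, fun j => ?_⟩
    · rw [mem_lexExponents, ← mem_lexExponents.1 ha, hc, ofLex_toLex]
      simp [Finset.sum_add_distrib]
    · have h1 : ofLex a j = c j := by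
        rw [hc, Pi.add_apply, Pi.single_eq_of_ne (ne_of_lt hj), add_zero]
      have h2 : j ≠ Fin.last n := ne_of_lt (lt_of_lt_of_le hj (Fin.le_last i))
      change (c + Pi.single (Fin.last n) 1 : Fin (n + 1) → ℕ) j = ofLex a j
      rw [h1, Pi.add_apply, Pi.single_eq_of_ne h2, add_zero]
    · change (c + Pi.single (Fin.last n) 1 : Fin (n + 1) → ℕ) i < ofLex a i
      rw [hc, Pi.add_apply, Pi.add_apply, Pi.single_eq_of_ne hil, Pi.single_eq_same]
      omega
    · rw [Finsupp.add_apply, complementExponent_apply, complementExponent_apply, hc, ofLex_toLex,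
        Pi.add_apply, Pi.add_apply]
      by_cases hj : j = i
      · subst hj
        rw [Pi.single_eq_same, Pi.single_eq_of_ne hil]
        omega
      · rw [Pi.single_eq_of_ne hj]
        omega
  -- At the first difference `b i < a i ≤ t`, so divisibility forces `m i ≠ 0`. This index is not
  -- the last one, as otherwise `|b| < |a|`.
  · rintro ⟨b, hb, ⟨i, hlt, hi⟩, hle⟩
    replace hi : ofLex b i < ofLex a i := hi
    have h1 := hle i
    have h2 := le_of_mem_lexExponents ha i
    rw [Finsupp.add_apply, complementExponent_apply, complementExponent_apply] at h1
    refine ⟨i, mem_colonVariables.2 ⟨?_, by omega⟩, by omega⟩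
    rintro rfl
    have h3 : ∑ j, ofLex b j < ∑ j, ofLex a j := by
      refine Finset.sum_lt_sum (fun j _ => ?_) ⟨_, Finset.mem_univ _, hi⟩
      rcases (Fin.le_last j).eq_or_lt with rfl | hj
      · exact hi.le
      · exact (hlt j hj).le
    rw [mem_lexExponents.1 ha, mem_lexExponents.1 hb] at h3
    exact lt_irrefl _ h3

lemma complementExponent_mem_polyPiece (k : Type u) [Field k] {t : ℕ}
    {a : Lex (Fin (n + 1) → ℕ)} (ha : a ∈ lexExponents n t) :
    monomial (complementExponent t a) (1 : k) ∈ polyPiece k (n + 1) ((n * t : ℕ) : ℤ) := by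
  refine isWeightedHomogeneous_monomial _ _ _ ?_
  -- The degree is `(n + 1) t - |a|`; adding `t = |a|` to both sides avoids truncated subtraction.
  have h : ∑ i, complementExponent t a i + t = n * t + t := by
    conv_lhs => rw [← mem_lexExponents.1 ha]
    rw [← Finset.sum_add_distrib, Finset.sum_congr rfl fun i _ => ?_]
    rotate_left
    · exact fun _ => t
    · rw [complementExponent_apply, mem_lexExponents.1 ha,
        Nat.sub_add_cancel (le_of_mem_lexExponents ha i)]
    · simp [add_mul]
  rw [Finsupp.weight_apply, Finsupp.sum_fintype _ _ (by simp), ← add_right_cancel h]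
  simp

lemma cyclePathIdeal_pow_eq_lex (k : Type u) [Field k] (t : ℕ) :
    cyclePathIdeal k (n + 1) n ^ t =
      monomialIdeal k (complementExponent t '' (lexExponents n t : Set (Lex (Fin (n + 1) → ℕ)))) := by
  rw [cyclePathIdeal_pow_eq_monomialIdeal]
  congr 1
  ext s
  constructor
  · rintro ⟨a, ha, hsa⟩
    refine ⟨toLex a, mem_lexExponents.2 ha, Finsupp.ext fun i => ?_⟩
    rw [complementExponent_apply, ofLex_toLex, ← hsa i, Nat.add_sub_cancel]
  · rintro ⟨a, ha, rfl⟩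
    exact ⟨ofLex a, mem_lexExponents.1 ha, fun i => by
      rw [complementExponent_apply, Nat.sub_add_cancel (le_of_mem_lexExponents ha i)]⟩

end LinearQuotients

end GradedPoly

theorem corollary3 {k : Type u} [Field k] (n t : ℕ) (hn : 3 ≤ n) (ht : 1 ≤ t) :
    GradedPoly.idealProjDim (GradedPoly.cyclePathIdeal k n (n - 1) ^ t) =
        ((min (n - 1) t : ℕ) : WithBot ℕ∞) ∧
      GradedPoly.idealRegularity (GradedPoly.cyclePathIdeal k n (n - 1) ^ t) =
        ((((n - 1) * t : ℕ) : ℤ) : WithTop ℤ) := by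
  obtain ⟨n, rfl⟩ := Nat.exists_eq_add_of_le' (show 1 ≤ n by omega)
  rw [Nat.add_sub_cancel, GradedPoly.cyclePathIdeal_pow_eq_lex]
  obtain ⟨hv, hs⟩ := GradedPoly.vanishes_and_survives_of_linear_quotients
    (GradedPoly.canonicalResolution k (n + 1)) (GradedPoly.lexExponents n t)
    (GradedPoly.complementExponent t) ((n * t : ℕ) : ℤ)
    (fun a ha => GradedPoly.complementExponent_mem_polyPiece k ha) GradedPoly.colonVariables
    (fun a ha => GradedPoly.exists_mem_colonVariables_iff ha) (min n t) (by omega)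
    (fun a ha => GradedPoly.card_colonVariables_le ha)
    (GradedPoly.exists_card_colonVariables_eq n t)
  exact GradedPoly.idealProjDim_eq_and_idealRegularity_eq
    (GradedPoly.isHomogeneousIdeal_monomialIdeal _) hv hs
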